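/- Let $T\ge 1$ and let $\mathcal I_1,\dots,\mathcal I_T,\mathcal O_1,\dots,\mathcal O_T$ be finite nonempty sets. **Process functions.** A map $w:\prod_{k}\mathcal O_k\to\prod_{k}\mathcal I_k$ (with induced functions $w_k:\prod_{k'}\mathcal O_{k'}\to\mathcal I_k$) is a *process function*, or $T$-slot classical-deterministic process, if for all functions $\mu_k:\mathcal I_k\to\mathcal O_k$ $(1\le k\le T)$ there is exactly one $\vec i\in\prod_k\mathcal I_k$ with $w(\mu_1(i_1),\dots,\mu_T(i_T))=\vec i$. Then $w_k(\vec o)$ does not depend on $o_k$, and for $\mu_k:\mathcal I_k\to\mathcal O_k$ the *reduced process* $w^{|\mu_k}$ is the $(T-1)$-slot process function on the remaining slots with $w^{|\mu_k}_{k'}(\vec o_{\setminus k})=w_{k'}\big(\vec o_{\setminus k},\,\mu_k(w_k(\vec o_{\setminus k}))\big)$ for $k'\ne k$. A process function $w$ is *causally definite* if $T=1$, or if $T\ge2$ and there is a $k$ such that $w_k$ is constant and, for every $\mu_k:\mathcal I_k\to\mathcal O_k$, $w^{|\mu_k}$ is causally definite. **Process matrices.** Let $H^{I_k}$, $H^{O_k}$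 be finite-dimensional nonzero Hilbert spaces with fixed computational bases. CP maps from $L(H^{I_k})$ to $L(H^{O_k})$ are identified with their Choi matrices, i.e. the matrices $M_k\ge0$ on $H^{I_k}\otimes H^{O_k}$; a channel is a CP map with $\mathrm{Tr}_{O_k}M_k=\mathbb 1$. The link product is $A^{XY}*B^{YZ}=\mathrm{Tr}_Y[(A\otimes\mathbb 1^Z)^{\mathsf T_Y}(\mathbb 1^X\otimes B)]$. A $T$-slot *process matrix* is a positive semidefinite matrix $W$ on $\bigotimes_k(H^{I_k}\otimes H^{O_k})$ with $W*(M_1\otimes\dots\otimes M_T)=1$ for all channels $M_1,\dots,M_T$. It is *compatible with the $k$th operation acting first* if, for every CP map $M_k$ in slot $k$, the number $W*(M_1\otimes\dots\otimes M_T)$ is the same for all choices of channels $M_j$, $j\ne k$. Every process matrix with $T=1$ is *causally separable*. For $T\ge2$, a process matrix $W$ is *causally separable* (in the sense of Wechs et al.) if for all finite-dimensional spaces $H^{I'_1},\dots,H^{I'_T}$ extending the input spaces and every density matrix $\rho$ on $\bigotimes_kH^{I'_k}$ there is a decomposition $$W\otimes\rho=\sum_{k=1}^Tq_kW_{(k)}^\rho,\qquad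 q_k\ge0,\quad\sum_kq_k=1,$$ where each $W_{(k)}^\rho$ is a $T$-slot process matrix (with input spaces $H^{I_k}\otimes H^{I'_k}$ and output spaces $H^{O_k}$) compatible with the $k$th operation acting first, such that for every CP map $M_k\ge0$ on $H^{I_k}\otimes H^{I'_k}\otimes H^{O_k}$ the conditional matrix $W_{(k)}^\rho*M_k$ is a nonnegative multiple of a causally separable $(T-1)$-slot process matrix. **Statement.** Let $w:\prod_k\mathcal O_k\to\prod_k\mathcal I_k$ be a process function and let $$\widetilde W=\sum_{\vec o\in\prod_k\mathcal O_k}|\vec o\rangle\langle\vec o|\otimes|w(\vec o)\rangle\langle w(\vec o)|$$ be its diagonal $0/1$ process matrix on $\bigotimes_k(H^{I_k}\otimes H^{O_k})$, where $H^{I_k}=\mathbb C^{\mathcal I_k}$ and $H^{O_k}=\mathbb C^{\mathcal O_k}$. Then $w$ is causally definite if and only if $\widetilde W$ is causally separable. -/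

import Mathlib

open scoped ComplexOrder

universe u v

namespace CausalProcess

/-! ### Process functions -/

section Functions

/-- `w : ∏ₖ Oₖ → ∏ₖ Iₖ` is a process function (a classical-deterministic process): for all
operations `μₖ : Iₖ → Oₖ`, the map `i ↦ w (μ i)` has exactly one fixed point. -/
def IsProcessFunction {T : ℕ} {I : Fin T → Type u} {O : Fin T → Type v}
    (w : (∀ k, O k) → ∀ k, I k) : Prop :=
  ∀ μ : ∀ k, I k → O k, ∃! i : ∀ k, I k, w (fun k => μ k (i k)) = i

/-- For a process function, the input `wₖ(o)` received in slot `k` does not depend on the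
output `oₖ` of slot `k`. -/
theorem IsProcessFunction.apply_update {T : ℕ} {I : Fin T → Type u} {O : Fin T → Type v}
    {w : (∀ k, O k) → ∀ k, I k} (hw : IsProcessFunction w) (k : Fin T) (o : ∀ j, O j)
    (a b : O k) : w (Function.update o k a) k = w (Function.update o k b) k := by
  classical
  by_contra hne
  set i₀ := w (Function.update o k a) k with hi₀
  let ν : I k → O k := fun x => if x = i₀ then b else a
  let μ : ∀ j, I j → O j := Function.update (fun j _ => o j) k ν
  obtain ⟨i, hi, -⟩ := hw μ
  have hμ : (fun j => μ j (i j)) = Function.update o k (ν (i k)) := by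
    funext j
    by_cases hj : j = k
    · subst hj; simp [μ]
    · simp [μ, hj]
  have hi' : w (fun j => μ j (i j)) = i := hi
  rw [hμ] at hi'
  have hk := congrFun hi' k
  by_cases hx : i k = i₀
  · have hν : ν (i k) = b := by simp [ν, hx]
    rw [hν] at hk
    exact hne (hx.symm.trans hk.symm)
  · have hν : ν (i k) = a := by simp [ν, hx]
    rw [hν] at hk
    exact hx hk.symm

/-- The input `wₖ(o_{∖k})` received in slot `k` when the other slots output `o`. The output of
slot `k` is irrelevant for a process function (`IsProcessFunction.apply_update`), and is filled
with an arbitrary element of `Oₖ`. -/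
noncomputable def slotInput {T : ℕ} {I : Fin (T + 1) → Type u} {O : Fin (T + 1) → Type v}
    [∀ k, Nonempty (O k)] (w : (∀ k, O k) → ∀ k, I k) (k : Fin (T + 1))
    (o : ∀ j, O (k.succAbove j)) : I k :=
  w (k.insertNth (Classical.arbitrary (O k)) o) k

/-- The reduced process `w^{|μₖ}`: the operation `μ` is inserted in slot `k`, and the remaining
slots are renumbered in increasing order. -/
noncomputable def reduced {T : ℕ} {I : Fin (T + 1) → Type u} {O : Fin (T + 1) → Type v}
    [∀ k, Nonempty (O k)] (w : (∀ k, O k) → ∀ k, I k) (k : Fin (T + 1)) (μ : I k → O k)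
    (o : ∀ j, O (k.succAbove j)) : ∀ j, I (k.succAbove j) :=
  fun j => w (k.insertNth (μ (slotInput w k o)) o) (k.succAbove j)

/-- Causal definiteness of a process function without global past and future. Every one-slot
process is causally definite; a process with at least two slots is causally definite if some
induced function `wₖ` is constant and, for every operation `μ` in slot `k`, the reduced process
is causally definite. (The value at zero slots is a convention that is not used.) -/
def IsCausallyDefinite : (T : ℕ) → (I : Fin T → Type u) → (O : Fin T → Type v) →
    [∀ k, Nonempty (O k)] → ((∀ k, O k) → ∀ k, I k) → Prop
  | 0, _, _, _, _ => True
  | 1, _, _, _, _ => True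
  | T + 2, I, O, _, w =>
      ∃ k : Fin (T + 2), (∃ i : I k, ∀ o, w o k = i) ∧
        ∀ μ : I k → O k,
          IsCausallyDefinite (T + 1) (fun j => I (k.succAbove j)) (fun j => O (k.succAbove j))
            (reduced w k μ)

end Functions

/-! ### Process matrices -/

section Matrices

/-- Labels of the computational basis of `⨂ₖ (H^{Iₖ} ⊗ H^{Oₖ})`. -/
abbrev Idx {T : ℕ} (I : Fin T → Type u) (O : Fin T → Type v) : Type (max u v) :=
  ∀ k, I k × O k

/-- Operators on `⨂ₖ (H^{Iₖ} ⊗ H^{Oₖ})`, as matrices in the computational basis. -/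
abbrev Op {T : ℕ} (I : Fin T → Type u) (O : Fin T → Type v) : Type (max u v) :=
  Matrix (Idx I O) (Idx I O) ℂ

/-- Choi matrices of CP maps from `L(H^X)` to `L(H^Y)`. -/
def IsCPMap {X : Type u} {Y : Type v} (M : Matrix (X × Y) (X × Y) ℂ) : Prop :=
  M.PosSemidef

open Classical in
/-- Choi matrices of quantum channels (CPTP maps) from `L(H^X)` to `L(H^Y)`:
positive semidefinite matrices with `Tr_Y M = 𝟙_X`. -/
def IsChannel {X : Type u} {Y : Type v} [Fintype Y] (M : Matrix (X × Y) (X × Y) ℂ) : Prop :=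
  IsCPMap M ∧ ∀ x x' : X, ∑ y : Y, M (x, y) (x', y) = if x = x' then 1 else 0

/-- Density matrices. -/
def IsState {X : Type u} [Fintype X] (ρ : Matrix X X ℂ) : Prop :=
  ρ.PosSemidef ∧ ρ.trace = 1

/-- The tensor product `M₁ ⊗ ⋯ ⊗ M_T`. -/
def tensor {T : ℕ} {I : Fin T → Type u} {O : Fin T → Type v}
    (M : ∀ k, Matrix (I k × O k) (I k × O k) ℂ) : Op I O :=
  fun x y => ∏ k, M k (x k) (y k)

/-- The full link product `W * (M₁ ⊗ ⋯ ⊗ M_T) = Tr [Wᵀ (M₁ ⊗ ⋯ ⊗ M_T)]`, a scalar. -/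
def evaluate {T : ℕ} {I : Fin T → Type u} {O : Fin T → Type v} [∀ k, Fintype (I k)]
    [∀ k, Fintype (O k)] (W : Op I O) (M : ∀ k, Matrix (I k × O k) (I k × O k) ℂ) : ℂ :=
  (W.transpose * tensor M).trace

/-- Process matrices (with trivial global past and future): positive semidefinite matrices that
are normalised on all tuples of quantum channels. -/
def IsProcessMatrix {T : ℕ} {I : Fin T → Type u} {O : Fin T → Type v} [∀ k, Fintype (I k)]
    [∀ k, Fintype (O k)] (W : Op I O) : Prop :=
  W.PosSemidef ∧
    ∀ M : ∀ k, Matrix (I k × O k) (I k × O k) ℂ, (∀ k, IsChannel (M k)) → evaluate W M = 1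

/-- `W` is compatible with the `k`th operation acting first: whatever CP map is applied in slot
`k`, its probability does not depend on the channels applied in the other slots
(no signalling from the other slots to slot `k`). -/
def CompatibleFirst {T : ℕ} {I : Fin T → Type u} {O : Fin T → Type v} [∀ k, Fintype (I k)]
    [∀ k, Fintype (O k)] (W : Op I O) (k : Fin T) : Prop :=
  ∀ M N : ∀ j, Matrix (I j × O j) (I j × O j) ℂ, M k = N k → IsCPMap (M k) →
    (∀ j, j ≠ k → IsChannel (M j)) → (∀ j, j ≠ k → IsChannel (N j)) →
    evaluate W M = evaluate W N

/-- The conditional matrix `W_{|M} = W * M` for a map `M` in slot `k`. The link product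
`Tr_Y [W^{T_Y} (𝟙 ⊗ M)]`, with `Y = (IO)_k`, has the entries
`∑ a b, W (a, x) (b, y) * M a b` in the computational basis. -/
def conditional {T : ℕ} {I : Fin (T + 1) → Type u} {O : Fin (T + 1) → Type v}
    [∀ k, Fintype (I k)] [∀ k, Fintype (O k)] (W : Op I O) (k : Fin (T + 1))
    (M : Matrix (I k × O k) (I k × O k) ℂ) :
    Op (fun j => I (k.succAbove j)) (fun j => O (k.succAbove j)) :=
  fun x y => ∑ a : I k × O k, ∑ b : I k × O k,
    W (k.insertNth (α := fun j => I j × O j) a x) (k.insertNth (α := fun j => I j × O j) b y) *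
      M a b

/-- The operator `W ⊗ ρ`, where `ρ` lives on an extension `⨂ₖ H^{I'ₖ}` of the input spaces,
so that the `k`th input space of `W ⊗ ρ` is `H^{Iₖ} ⊗ H^{I'ₖ}`. -/
def extend {T : ℕ} {I : Fin T → Type u} {O : Fin T → Type v} {d : Fin T → ℕ} (W : Op I O)
    (ρ : Matrix (∀ k, Fin (d k)) (∀ k, Fin (d k)) ℂ) : Op (fun k => I k × Fin (d k)) O :=
  fun x y =>
    W (fun k => ((x k).1.1, (x k).2)) (fun k => ((y k).1.1, (y k).2)) *
      ρ (fun k => (x k).1.2) (fun k => (y k).1.2)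

/-- Causal separability. Every one-slot process matrix is causally separable. A process matrix
`W` with at least two slots is causally separable if, for every finite-dimensional extension of
the input spaces and every (possibly entangled) state `ρ` on it, `W ⊗ ρ = ∑ₖ qₖ Vₖ` with
convex weights `qₖ` and process matrices `Vₖ` compatible with the `k`th operation acting first,
such that for every CP map `M` in slot `k` (acting also on the extension) the conditional matrix
`Vₖ * M` is a nonnegative multiple of a causally separable process matrix with one slot less.
(The value at zero slots is a convention that is not used.) -/
def IsCausallySeparable : (T : ℕ) → (I : Fin T → Type u) → (O : Fin T → Type v) →
    [∀ k, Fintype (I k)] → [∀ k, Fintype (O k)] → Op I O → Prop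
  | 0, _, _, _, _, W => IsProcessMatrix W
  | 1, _, _, _, _, W => IsProcessMatrix W
  | T + 2, I, O, _, _, W =>
      IsProcessMatrix W ∧
        ∀ (d : Fin (T + 2) → ℕ) (ρ : Matrix (∀ k, Fin (d k)) (∀ k, Fin (d k)) ℂ), IsState ρ →
          ∃ (q : Fin (T + 2) → ℝ) (V : Fin (T + 2) → Op (fun k => I k × Fin (d k)) O),
            (∀ k, 0 ≤ q k) ∧ ∑ k, q k = 1 ∧ extend W ρ = ∑ k, (q k : ℂ) • V k ∧
            ∀ k, IsProcessMatrix (V k) ∧ CompatibleFirst (V k) k ∧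
              ∀ M : Matrix ((I k × Fin (d k)) × O k) ((I k × Fin (d k)) × O k) ℂ, IsCPMap M →
                ∃ (c : ℝ) (U : Op (fun j => I (k.succAbove j) × Fin (d (k.succAbove j)))
                    (fun j => O (k.succAbove j))),
                  0 ≤ c ∧
                  IsCausallySeparable (T + 1)
                    (fun j => I (k.succAbove j) × Fin (d (k.succAbove j)))
                    (fun j => O (k.succAbove j)) U ∧
                  conditional (V k) k M = (c : ℂ) • U

open Classical in
/-- The diagonal 0/1 matrix `∑ₒ |o⟩⟨o| ⊗ |w(o)⟩⟨w(o)|` of a function `w : ∏ₖ Oₖ → ∏ₖ Iₖ`. -/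
noncomputable def processMatrix {T : ℕ} {I : Fin T → Type u} {O : Fin T → Type v}
    (w : (∀ k, O k) → ∀ k, I k) : Op I O :=
  Matrix.diagonal fun x => if w (fun k => (x k).2) = (fun k => (x k).1) then 1 else 0

end Matrices

end CausalProcess

universe u₁ u₂

namespace CausalProcess

/-! ### Process functions and their reductions -/

section FunctionLemmas

variable {T : ℕ}

/-! From definite to separable, the induction runs over a class closed under extension and
conditioning: finite sums of branches, each a causally definite process function carrying a positive
auxiliary operator, with total trace 1 (`IsMixture`). An extension only enlarges the auxiliary
operators. Grouping the branches by a slot `k` whose input is constant gives the required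
decomposition (`IsMixture.exists_split`). Since such a slot sees one fixed input and the matrix is
diagonal in its output, conditioning on any CP map there sums over classical outputs `o`, each
reducing the function by the constant operation `o` (`conditional_branch`). Normalisation and
no-signalling on quantum channels follow from a product formula for process functions
(`IsProcessFunction.sum_prod`).

Conversely, one-dimensional extensions suffice and only diagonals are tracked. Positivity confines
the diagonal of a term of nonzero weight to the graph of `w`; normalisation makes it equal to the
graph's indicator (`IsProcessMatrix.diagEq`). Compatibility then makes `w` constant in slot `k`, and
conditioning on the classical channel of `μ` yields the diagonal of the reduced process, up to a
nonzero factor. -/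

theorem isProcessFunction_const {I : Fin T → Type*} {O : Fin T → Type*} (i : ∀ k, I k) :
    IsProcessFunction (fun _ : ∀ k, O k => i) :=
  fun _ => ⟨i, rfl, fun _ h => h.symm⟩

theorem isCausallyDefinite_const (n : ℕ) (I : Fin n → Type u) (O : Fin n → Type v)
    [∀ k, Nonempty (O k)] (i : ∀ k, I k) : IsCausallyDefinite n I O (fun _ => i) := by
  induction n with
  | zero => trivial
  | succ n ih =>
    cases n with
    | zero => trivial
    | succ n => exact ⟨0, ⟨i 0, fun _ => rfl⟩, fun μ => ih _ _ _⟩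

/-- Any value may be used in slot `k` to compute its input. -/
theorem IsProcessFunction.apply_insertNth_self {I : Fin (T + 1) → Type*} {O : Fin (T + 1) → Type*}
    [∀ k, Nonempty (O k)] {w : (∀ k, O k) → ∀ k, I k} (hw : IsProcessFunction w)
    (k : Fin (T + 1)) (a : O k) (o : ∀ j, O (k.succAbove j)) :
    w (k.insertNth a o) k = slotInput w k o := by
  have h := hw.apply_update k (k.insertNth a o) a (Classical.arbitrary (O k))
  simpa [slotInput, Fin.update_insertNth] using h

/-- Fixed points of the reduced process under `ν` correspond to those of `w` under `μ` in slot `k`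
and `ν` elsewhere: the missing coordinate must be the slot input. -/
theorem IsProcessFunction.reduced {I : Fin (T + 1) → Type*} {O : Fin (T + 1) → Type*}
    [∀ k, Nonempty (O k)] {w : (∀ k, O k) → ∀ k, I k} (hw : IsProcessFunction w)
    (k : Fin (T + 1)) (μ : I k → O k) : IsProcessFunction (reduced w k μ) := by
  intro ν
  obtain ⟨i, hi, huniq⟩ := hw (k.insertNth (α := fun j => I j → O j) μ ν)
  have key : ∀ (a : I k) (x : ∀ j, I (k.succAbove j)),
      (fun j => k.insertNth (α := fun j => I j → O j) μ ν j (k.insertNth (α := I) a x j)) =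
        k.insertNth (α := O) (μ a) (fun j => ν j (x j)) := by
    intro a x
    rw [Fin.eq_insertNth_iff]
    constructor
    · simp
    · funext j; simp [Fin.removeNth]
  have fix : ∀ x : ∀ j, I (k.succAbove j),
      CausalProcess.reduced w k μ (fun j => ν j (x j)) = x ↔
        k.insertNth (α := I) (slotInput w k fun j => ν j (x j)) x = i := by
    intro x
    constructor
    · intro hx
      apply huniq
      rw [key, Fin.eq_insertNth_iff]
      refine ⟨hw.apply_insertNth_self _ _ _, ?_⟩
      exact hx
    · intro hx
      have h2 := hi
      rw [← hx, key, Fin.eq_insertNth_iff] at h2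
      exact h2.2
  refine ⟨fun j => i (k.succAbove j), ?_, fun x hx => ?_⟩
  · refine (fix _).2 ?_
    symm
    rw [Fin.eq_insertNth_iff]
    refine ⟨?_, rfl⟩
    have h2 := hi
    have hi' : i = k.insertNth (α := I) (i k) (fun j => i (k.succAbove j)) := by
      rw [Fin.eq_insertNth_iff]; exact ⟨rfl, rfl⟩
    rw [hi', key] at h2
    rw [← hw.apply_insertNth_self k (μ (i k)), h2]
    simp
  · have h := (fix x).1 hx
    funext j
    rw [← h]; simp

end FunctionLemmas

/-! ### The product formula for process functions -/

section Counting

open Classical in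
theorem IsProcessFunction.sum_prod_deterministic {T : ℕ} {I : Fin T → Type*} {O : Fin T → Type*}
    [∀ k, Fintype (O k)] {w : (∀ k, O k) → ∀ k, I k}
    (hw : IsProcessFunction w) (μ : ∀ k, I k → O k) :
    ∑ o : ∀ k, O k, ∏ k, (if o k = μ k (w o k) then (1 : ℂ) else 0) = 1 := by
  obtain ⟨i, hi, huniq⟩ := hw μ
  have hi' : w (fun k => μ k (i k)) = i := hi
  have h : ∀ o : ∀ k, O k, ∏ k, (if o k = μ k (w o k) then (1 : ℂ) else 0) =
      if o = (fun k => μ k (i k)) then 1 else 0 := by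
    intro o
    have hiff : (∀ k, o k = μ k (w o k)) ↔ o = fun k => μ k (i k) := by
      constructor
      · intro h
        have ho : o = fun k => μ k (w o k) := funext h
        have : w o = i := huniq _ (congrArg w ho.symm)
        rw [this] at ho
        exact ho
      · rintro rfl k
        simp only [hi']
    by_cases ho : ∀ k, o k = μ k (w o k)
    · rw [if_pos (hiff.1 ho)]
      exact Finset.prod_eq_one fun k _ => if_pos (ho k)
    · rw [if_neg fun h => ho (hiff.2 h)]
      obtain ⟨k, hk⟩ := not_forall.1 ho
      exact Finset.prod_eq_zero (Finset.mem_univ k) (if_neg hk)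
  simp [h]

/-- The left side is linear in each `N k`, and a kernel with constant row sums is a linear
combination of deterministic ones. For deterministic kernels the sum counts fixed points. Positivity
plays no role, so off-diagonal blocks of channels are covered. The induction is on the set of slots
not yet known to be deterministic. -/
theorem IsProcessFunction.sum_prod {T : ℕ} {I : Fin T → Type*} {O : Fin T → Type*}
    [∀ k, Fintype (I k)] [∀ k, Fintype (O k)] [∀ k, Nonempty (O k)] {w : (∀ k, O k) → ∀ k, I k}
    (hw : IsProcessFunction w) (N : ∀ k, I k → O k → ℂ) (c : Fin T → ℂ)
    (hN : ∀ k i, ∑ o, N k i o = c k) :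
    ∑ o : ∀ k, O k, ∏ k, N k (w o k) (o k) = ∏ k, c k := by
  classical
  suffices H : ∀ (s : Finset (Fin T)) (N : ∀ k, I k → O k → ℂ) (c : Fin T → ℂ),
      (∀ k i, ∑ o, N k i o = c k) →
      (∀ k ∉ s, ∃ μ : I k → O k, ∀ i o, N k i o = if o = μ i then 1 else 0) →
      ∑ o : ∀ k, O k, ∏ k, N k (w o k) (o k) = ∏ k, c k from
    H Finset.univ N c hN (by simp)
  intro s
  induction s using Finset.induction_on with
  | empty =>
    intro N c hN h
    choose μ hμ using fun k => h k (by simp)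
    -- A row sum determines `c k` only if `I k` is inhabited; a value of `w` provides the element.
    have hc : ∀ k, I k → c k = 1 := fun k i => by rw [← hN k i]; simp [hμ]
    have hc' : ∏ k, c k = 1 :=
      Finset.prod_eq_one fun k _ => hc k (w (fun _ => Classical.arbitrary _) k)
    rw [hc', ← hw.sum_prod_deterministic μ]
    simp only [hμ]
  | insert k s hk ih =>
    intro N c hN h
    set o₀ : O k := Classical.arbitrary _
    let D : (I k → O k) → I k → O k → ℂ := fun μ i o => if o = μ i then 1 else 0
    let F : (I k → O k → ℂ) → ℂ := fun n =>
      ∑ o : ∀ k, O k, ∏ j, Function.update N k n j (w o j) (o j)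
    have hF : ∀ n, F n = ∑ o : ∀ k, O k, n (w o k) (o k) *
        ∏ j ∈ Finset.univ.erase k, N j (w o j) (o j) := by
      intro n
      refine Finset.sum_congr rfl fun o _ => ?_
      rw [← Finset.mul_prod_erase _ _ (Finset.mem_univ k)]
      congr 1
      · simp
      · refine Finset.prod_congr rfl fun j hj => ?_
        rw [Function.update_of_ne (Finset.ne_of_mem_erase hj)]
    have hD : ∀ μ, F (D μ) = ∏ j ∈ Finset.univ.erase k, c j := by
      intro μ
      have := ih (Function.update N k (D μ)) (Function.update c k 1) ?_ ?_
      · refine this.trans ?_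
        rw [← Finset.mul_prod_erase _ _ (Finset.mem_univ k)]
        simp only [Function.update_self, one_mul]
        refine Finset.prod_congr rfl fun j hj => ?_
        rw [Function.update_of_ne (Finset.ne_of_mem_erase hj)]
      · intro j i
        by_cases hj : j = k
        · subst hj; simp [D]
        · simp [hj, hN]
      · intro j hj
        by_cases hjk : j = k
        · subst hjk; exact ⟨μ, fun i o => by simp [D]⟩
        · obtain ⟨ν, hν⟩ := h j (by simp [hj, hjk])
          exact ⟨ν, fun i o => by simp [hjk, hν]⟩
    -- Each correction changes the constant function `o₀` at one input. By `hD` the value of `F` is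
    -- the same on all deterministic kernels, so every correction contributes zero.
    have hdecomp : ∀ i o, N k i o = c k * D (fun _ => o₀) i o + ∑ i', ∑ o', N k i' o' *
        (D (Function.update (fun _ => o₀) i' o') i o - D (fun _ => o₀) i o) := by
      intro i o
      have h1 : ∀ i', i' ≠ i → ∑ o', N k i' o' *
        (D (Function.update (fun _ => o₀) i' o') i o - D (fun _ => o₀) i o) = 0 := by
        intro i' hi'
        refine Finset.sum_eq_zero fun o' _ => ?_
        simp [D, Function.update_of_ne hi'.symm]
      rw [Fintype.sum_eq_single i h1]
      simp only [mul_sub, Finset.sum_sub_distrib, ← Finset.sum_mul, hN]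
      simp [D]
    have hlin : F (N k) = c k * F (D fun _ => o₀) + ∑ i', ∑ o', N k i' o' *
        (F (D (Function.update (fun _ => o₀) i' o')) - F (D fun _ => o₀)) := by
      simp only [hF, ← Finset.sum_sub_distrib, ← sub_mul, Finset.mul_sum]
      rw [Finset.sum_congr rfl fun i' _ => Finset.sum_comm, Finset.sum_comm,
        ← Finset.sum_add_distrib]
      refine Finset.sum_congr rfl fun o _ => ?_
      rw [hdecomp]
      simp only [add_mul, Finset.sum_mul, mul_assoc]
    have : F (N k) = ∏ j, c j := by
      rw [hlin]
      simp only [hD, sub_self, mul_zero, Finset.sum_const_zero, add_zero]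
      exact Finset.mul_prod_erase _ _ (Finset.mem_univ k)
    simpa [F] using this

end Counting

/-! ### Branches: a process function with an auxiliary operator -/

section Branch

variable {T : ℕ} {I : Fin T → Type*} {A : Fin T → Type*} {J : Fin T → Type*} {O : Fin T → Type*}

open Classical in
/-- The process matrix of the function `w`, tensored with the operator `ρ` on auxiliary input
spaces. The `k`th input space has the basis `Jₖ ≃ Iₖ × Aₖ`. -/
noncomputable def branch (e : ∀ k, J k ≃ I k × A k) (w : (∀ k, O k) → ∀ k, I k)
    (ρ : Matrix (∀ k, A k) (∀ k, A k) ℂ) : Op J O :=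
  fun x y =>
    if (fun k => (x k).2) = (fun k => (y k).2) ∧ w (fun k => (x k).2) = (fun k => (e k (x k).1).1) ∧
        w (fun k => (y k).2) = (fun k => (e k (y k).1).1) then
      ρ (fun k => (e k (x k).1).2) (fun k => (e k (y k).1).2)
    else 0

theorem branch_smul (e : ∀ k, J k ≃ I k × A k) (w : (∀ k, O k) → ∀ k, I k) (c : ℂ)
    (ρ : Matrix (∀ k, A k) (∀ k, A k) ℂ) : branch e w (c • ρ) = c • branch e w ρ := by
  ext x y
  simp [branch]

theorem branch_zero (e : ∀ k, J k ≃ I k × A k) (w : (∀ k, O k) → ∀ k, I k) :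
    branch e w 0 = 0 := by
  ext x y
  simp [branch]

/-- By the Schur product theorem: the pullback of `1` along outputs times the pullback of `ρ`,
compressed to the graph of `w`. -/
theorem branch_posSemidef [∀ k, Fintype (J k)] [∀ k, Fintype (O k)] (e : ∀ k, J k ≃ I k × A k)
    (w : (∀ k, O k) → ∀ k, I k) {ρ : Matrix (∀ k, A k) (∀ k, A k) ℂ} (hρ : ρ.PosSemidef) :
    (branch e w ρ).PosSemidef := by
  classical
  let out : Idx J O → ∀ k, O k := fun x k => (x k).2
  let g : Idx J O → ∀ k, A k := fun x k => (e k (x k).1).2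
  let D : Matrix (Idx J O) (Idx J O) ℂ :=
    Matrix.diagonal fun x => if w (fun k => (x k).2) = (fun k => (e k (x k).1).1) then 1 else 0
  have h := ((Matrix.PosSemidef.one (n := ∀ k, O k) (R := ℂ)).submatrix out).hadamard
    (hρ.submatrix g) |>.mul_mul_conjTranspose_same D
  convert! h using 1
  ext x y
  simp only [D, Matrix.diagonal_conjTranspose, Matrix.mul_diagonal, Matrix.diagonal_mul,
    Matrix.hadamard_apply, Matrix.submatrix_apply, Matrix.one_apply, branch, Pi.star_apply, out, g]
  split_ifs <;> simp_all

variable [∀ k, Fintype (I k)] [∀ k, Fintype (A k)] [∀ k, Fintype (J k)] [∀ k, Fintype (O k)]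

theorem sum_idx {R : Type*} [AddCommMonoid R] (e : ∀ k, J k ≃ I k × A k) (f : Idx J O → R) :
    ∑ x, f x = ∑ o : ∀ k, O k, ∑ a : ∀ k, A k, ∑ i : ∀ k, I k,
      f fun k => ((e k).symm (i k, a k), o k) := by
  let E : Idx J O ≃ (∀ k, O k) × (∀ k, A k) × (∀ k, I k) :=
    { toFun := fun x => (fun k => (x k).2, fun k => (e k (x k).1).2, fun k => (e k (x k).1).1)
      invFun := fun p k => ((e k).symm (p.2.2 k, p.2.1 k), p.1 k)
      left_inv := fun x => by simp
      right_inv := fun p => by simp }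
  rw [← Equiv.sum_comp E.symm, Fintype.sum_prod_type]
  refine Finset.sum_congr rfl fun o _ => ?_
  rw [Fintype.sum_prod_type]
  rfl

omit [∀ k, Fintype (I k)] [∀ k, Fintype (A k)] in
theorem evaluate_eq_sum (W : Op J O) (M : ∀ k, Matrix (J k × O k) (J k × O k) ℂ) :
    evaluate W M = ∑ x, ∑ y, W x y * ∏ k, M k (x k) (y k) := by
  simp only [evaluate, Matrix.trace, Matrix.diag, Matrix.mul_apply, Matrix.transpose_apply, tensor]
  exact Finset.sum_comm

omit [∀ k, Fintype (I k)] [∀ k, Fintype (A k)] in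
theorem evaluate_sum {S : Type*} (s : Finset S) (W : S → Op J O)
    (M : ∀ k, Matrix (J k × O k) (J k × O k) ℂ) :
    evaluate (∑ i ∈ s, W i) M = ∑ i ∈ s, evaluate (W i) M := by
  simp only [evaluate, Matrix.transpose_sum, Finset.sum_mul, Matrix.trace_sum]

theorem evaluate_branch (e : ∀ k, J k ≃ I k × A k) (w : (∀ k, O k) → ∀ k, I k)
    (ρ : Matrix (∀ k, A k) (∀ k, A k) ℂ) (M : ∀ k, Matrix (J k × O k) (J k × O k) ℂ) :
    evaluate (branch e w ρ) M = ∑ a, ∑ b, ρ a b * ∑ o : ∀ k, O k, ∏ k,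
      M k ((e k).symm (w o k, a k), o k) ((e k).symm (w o k, b k), o k) := by
  classical
  rw [evaluate_eq_sum, sum_idx e]
  simp only [Finset.mul_sum]
  rw [Finset.sum_comm]
  refine Finset.sum_congr rfl fun a _ => ?_
  conv_rhs => rw [Finset.sum_comm]
  refine Finset.sum_congr rfl fun o _ => ?_
  rw [Fintype.sum_eq_single (w o)]
  · rw [sum_idx e, Fintype.sum_eq_single o]
    · refine Finset.sum_congr rfl fun b _ => ?_
      rw [Fintype.sum_eq_single (w o)]
      · simp [branch]
      · intro i hi
        simp [branch, hi.symm]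
    · intro o' ho
      simp [branch, ho.symm]
  · intro i hi
    simp [branch, hi.symm]

end Branch

/-! ### Conditioning a branch on its first slot -/

section Link

variable {T : ℕ}

/-- The partial link product of `ρ` with the operator `N` on the `k`th tensor factor. -/
def linkSlot {A : Fin (T + 1) → Type*} [∀ k, Fintype (A k)] (k : Fin (T + 1))
    (ρ : Matrix (∀ k, A k) (∀ k, A k) ℂ) (N : Matrix (A k) (A k) ℂ) :
    Matrix (∀ j, A (k.succAbove j)) (∀ j, A (k.succAbove j)) ℂ :=
  fun a b => ∑ α, ∑ β, ρ (k.insertNth α a) (k.insertNth β b) * N α β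

/-- Again the Schur product theorem; the double sum over slot `k` is then a congruence by the 0/1
matrix `K`. -/
theorem linkSlot_posSemidef {A : Fin (T + 1) → Type*} [∀ k, Fintype (A k)] (k : Fin (T + 1))
    {ρ : Matrix (∀ k, A k) (∀ k, A k) ℂ} {N : Matrix (A k) (A k) ℂ} (hρ : ρ.PosSemidef)
    (hN : N.PosSemidef) : (linkSlot k ρ N).PosSemidef := by
  classical
  let f : A k × (∀ j, A (k.succAbove j)) → ∀ k, A k := fun p => k.insertNth p.1 p.2
  obtain ⟨K, hK⟩ : ∃ K : Matrix (∀ j, A (k.succAbove j)) (A k × (∀ j, A (k.succAbove j))) ℂ,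
      ∀ a p, K a p = if p.2 = a then 1 else 0 := ⟨fun a p => _, fun _ _ => rfl⟩
  have h : linkSlot k ρ N =
      K * (ρ.submatrix f f).hadamard (N.submatrix Prod.fst Prod.fst) * K.conjTranspose := by
    ext a b
    rw [Matrix.mul_apply, Fintype.sum_prod_type, linkSlot, Finset.sum_comm]
    refine Finset.sum_congr rfl fun β _ => ?_
    simp [hK, f, Matrix.mul_apply, Fintype.sum_prod_type, apply_ite star]
  rw [h]
  exact ((hρ.submatrix f).hadamard (hN.submatrix Prod.fst)).mul_mul_conjTranspose_same K

variable {I : Fin (T + 1) → Type*} {A : Fin (T + 1) → Type*} {J : Fin (T + 1) → Type*}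
  {O : Fin (T + 1) → Type*}

theorem insertNth_map {B C : Fin (T + 1) → Type*} (k : Fin (T + 1)) (g : ∀ j, B j → C j) (a : B k)
    (x : ∀ j, B (k.succAbove j)) :
    (fun j => g j (k.insertNth (α := B) a x j)) =
      k.insertNth (α := C) (g k a) (fun j => g (k.succAbove j) (x j)) := by
  rw [Fin.eq_insertNth_iff]
  constructor
  · simp
  · funext j; simp [Fin.removeNth]

open Classical in
theorem branch_insertNth [∀ k, Nonempty (O k)] (e : ∀ k, J k ≃ I k × A k)
    {w : (∀ k, O k) → ∀ k, I k} (k : Fin (T + 1))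
    {i : I k} (hi : ∀ o, w o k = i) (ρ : Matrix (∀ k, A k) (∀ k, A k) ℂ)
    (p q : I k × A k) (o o' : O k) (x y : Idx (fun j => J (k.succAbove j))
      (fun j => O (k.succAbove j))) :
    branch e w ρ (k.insertNth (α := fun j => J j × O j) ((e k).symm p, o) x)
        (k.insertNth (α := fun j => J j × O j) ((e k).symm q, o') y) =
      if p.1 = i ∧ q.1 = i ∧ o' = o then
        branch (fun j => e (k.succAbove j)) (reduced w k fun _ => o)
          (fun a b => ρ (k.insertNth p.2 a) (k.insertNth q.2 b)) x y else 0 := by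
  have hred : ∀ (o : O k) (o' : ∀ j, O (k.succAbove j)) (i' : I k) (f : ∀ j, I (k.succAbove j)),
      w (k.insertNth (α := O) o o') = k.insertNth (α := I) i' f ↔
        i' = i ∧ reduced w k (fun _ => o) o' = f := by
    intro o o' i' f
    rw [Fin.eq_insertNth_iff, hi]
    exact and_congr eq_comm Iff.rfl
  unfold branch
  rw [insertNth_map k (fun j (z : J j × O j) => z.2), insertNth_map k (fun j (z : J j × O j) => z.2),
    insertNth_map k (fun j (z : J j × O j) => (e j z.1).1),
    insertNth_map k (fun j (z : J j × O j) => (e j z.1).1),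
    insertNth_map k (fun j (z : J j × O j) => (e j z.1).2),
    insertNth_map k (fun j (z : J j × O j) => (e j z.1).2)]
  simp only [hred, Fin.insertNth_inj, Equiv.apply_symm_apply]
  rw [← ite_and]
  refine if_congr ?_ rfl rfl
  constructor
  · rintro ⟨⟨rfl, h⟩, ⟨h1, h2⟩, h3, h4⟩
    exact ⟨⟨h1, h3, rfl⟩, h, h2, h4⟩
  · rintro ⟨⟨h1, h3, rfl⟩, h, h2, h4⟩
    exact ⟨⟨rfl, h⟩, ⟨h1, h2⟩, h3, h4⟩

variable [∀ k, Fintype (I k)] [∀ k, Fintype (A k)] [∀ k, Fintype (J k)] [∀ k, Fintype (O k)]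

/-- Only the blocks of `M` with input `i` and equal outputs `o` survive. Coherence in `M` therefore
affects the auxiliary operator alone, while the function sees a classical output. -/
theorem conditional_branch [∀ k, Nonempty (O k)] (e : ∀ k, J k ≃ I k × A k)
    {w : (∀ k, O k) → ∀ k, I k} (k : Fin (T + 1)) {i : I k}
    (hi : ∀ o, w o k = i) (ρ : Matrix (∀ k, A k) (∀ k, A k) ℂ)
    (M : Matrix (J k × O k) (J k × O k) ℂ) :
    conditional (branch e w ρ) k M = ∑ o : O k,
      branch (fun j => e (k.succAbove j)) (reduced w k fun _ => o)
        (linkSlot k ρ fun α β => M ((e k).symm (i, α), o) ((e k).symm (i, β), o)) := by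
  classical
  have hsum : ∀ f : J k × O k → ℂ, ∑ a, f a = ∑ o, ∑ α, ∑ i', f ((e k).symm (i', α), o) := by
    intro f
    rw [Fintype.sum_prod_type_right]
    refine Finset.sum_congr rfl fun o _ => ?_
    rw [← Equiv.sum_comp (e k).symm, Fintype.sum_prod_type_right]
  ext x y
  rw [Matrix.sum_apply]
  simp only [conditional]
  rw [hsum]
  refine Finset.sum_congr rfl fun o _ => ?_
  have h1 : ∀ α, ∑ i', ∑ b, branch e w ρ
      (k.insertNth (α := fun j => J j × O j) ((e k).symm (i', α), o) x)
      (k.insertNth (α := fun j => J j × O j) b y) * M ((e k).symm (i', α), o) b =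
      ∑ β, branch (fun j => e (k.succAbove j)) (reduced w k fun _ => o)
          (fun a b => ρ (k.insertNth α a) (k.insertNth β b)) x y *
        M ((e k).symm (i, α), o) ((e k).symm (i, β), o) := by
    intro α
    rw [Fintype.sum_eq_single i]
    · rw [hsum, Fintype.sum_eq_single o]
      · refine Finset.sum_congr rfl fun β _ => ?_
        rw [Fintype.sum_eq_single i]
        · rw [branch_insertNth e k hi, if_pos ⟨rfl, rfl, rfl⟩]
        · intro i' hi'
          rw [branch_insertNth e k hi, if_neg (fun h => hi' h.2.1), zero_mul]
      · intro o' ho'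
        refine Finset.sum_eq_zero fun β _ => Finset.sum_eq_zero fun i' _ => ?_
        rw [branch_insertNth e k hi, if_neg (fun h => ho' h.2.2), zero_mul]
    · intro i' hi'
      rw [hsum]
      refine Finset.sum_eq_zero fun o' _ => Finset.sum_eq_zero fun β _ =>
        Finset.sum_eq_zero fun i'' _ => ?_
      rw [branch_insertNth e k hi, if_neg (fun h => hi' h.1), zero_mul]
  rw [Finset.sum_congr rfl fun α _ => h1 α]
  unfold branch
  split_ifs
  · rfl
  · simp

end Link

/-! ### Mixtures of branches -/

section Mixture

variable {T : ℕ} {I : Fin T → Type*} {A : Fin T → Type*} {J : Fin T → Type*} {O : Fin T → Type v}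

/-- Probabilistic mixtures of process matrices of functions satisfying `P`, each tensored with a
(subnormalised) state on auxiliary input spaces. -/
def IsMixture [∀ k, Fintype (A k)] (e : ∀ k, J k ≃ I k × A k)
    (P : ((∀ k, O k) → ∀ k, I k) → Prop) (W : Op J O) : Prop :=
  ∃ (S : Type v) (_ : Fintype S) (w : S → (∀ k, O k) → ∀ k, I k)
    (ρ : S → Matrix (∀ k, A k) (∀ k, A k) ℂ),
    (∀ s, P (w s)) ∧ (∀ s, (ρ s).PosSemidef) ∧ ∑ s, (ρ s).trace = 1 ∧
      W = ∑ s, branch e (w s) (ρ s)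

theorem isMixture_branch [∀ k, Fintype (A k)] {e : ∀ k, J k ≃ I k × A k}
    {P : ((∀ k, O k) → ∀ k, I k) → Prop} {w : (∀ k, O k) → ∀ k, I k}
    {ρ : Matrix (∀ k, A k) (∀ k, A k) ℂ} (hw : P w) (hρ : IsState ρ) :
    IsMixture e P (branch e w ρ) :=
  ⟨PUnit, inferInstance, fun _ => w, fun _ => ρ, fun _ => hw, fun _ => hρ.1, by simpa using hρ.2,
    by simp⟩

section

variable [∀ k, Fintype (A k)] {e : ∀ k, J k ≃ I k × A k} {P : ((∀ k, O k) → ∀ k, I k) → Prop}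

theorem IsMixture.nonempty_aux {W : Op J O} (h : IsMixture e P W) (k : Fin T) :
    Nonempty (A k) := by
  obtain ⟨S, hS, w, ρ, hP, hρ, htr, rfl⟩ := h
  by_contra hk
  have : IsEmpty (A k) := not_nonempty_iff.1 hk
  have : IsEmpty (∀ k, A k) := ⟨fun a => isEmptyElim (a k)⟩
  simp [Matrix.trace] at htr

/-- A sum of branches is a multiple of a mixture. -/
theorem exists_isMixture_smul [∀ k, Nonempty (A k)] (hP₀ : ∃ w, P w) {S : Type v} [Fintype S]
    (w : S → (∀ k, O k) → ∀ k, I k) (ρ : S → Matrix (∀ k, A k) (∀ k, A k) ℂ) (hP : ∀ s, P (w s))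
    (hρ : ∀ s, (ρ s).PosSemidef) :
    ∃ U, 0 ≤ (∑ s, (ρ s).trace).re ∧ IsMixture e P U ∧
      ∑ s, branch e (w s) (ρ s) = (((∑ s, (ρ s).trace).re : ℝ) : ℂ) • U := by
  classical
  set t : ℂ := ∑ s, (ρ s).trace with ht
  have ht0 : 0 ≤ t := Finset.sum_nonneg fun s _ => (hρ s).trace_nonneg
  have htre : ((t.re : ℝ) : ℂ) = t := (Complex.eq_re_of_ofReal_le (r := 0) (by simpa using ht0)).symm
  have htre0 : 0 ≤ t.re := (Complex.nonneg_iff.1 ht0).1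
  rw [htre]
  by_cases h0 : t = 0
  -- At total weight zero every branch vanishes, so any mixture can serve as `U`.
  · obtain ⟨w₀, hw₀⟩ := hP₀
    have a₀ : ∀ k, A k := fun k => Classical.arbitrary _
    have hst : IsState (Matrix.diagonal fun a : ∀ k, A k => if a = a₀ then (1 : ℂ) else 0) := by
      refine ⟨Matrix.PosSemidef.diagonal fun a => ?_, by simp [Matrix.trace_diagonal]⟩
      simp only [Pi.zero_apply]
      split_ifs <;> simp
    refine ⟨_, htre0, isMixture_branch hw₀ hst, ?_⟩
    rw [h0, zero_smul]
    refine Finset.sum_eq_zero fun s _ => ?_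
    have h := (Finset.sum_eq_zero_iff_of_nonneg fun s _ => (hρ s).trace_nonneg).1
      (ht.symm.trans h0) s (Finset.mem_univ s)
    rw [(hρ s).trace_eq_zero_iff.1 h, branch_zero]
  · have hinv : 0 ≤ t⁻¹ := by
      rw [← htre, ← Complex.ofReal_inv, Complex.zero_le_real]
      exact inv_nonneg.2 htre0
    refine ⟨∑ s, branch e (w s) (t⁻¹ • ρ s), htre0, ⟨S, inferInstance, w, fun s => t⁻¹ • ρ s, hP,
      fun s => (hρ s).smul hinv, ?_, rfl⟩, ?_⟩
    · simp only [Matrix.trace_smul, ← Finset.smul_sum]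
      rw [← ht, smul_eq_mul, inv_mul_cancel₀ h0]
    · simp only [branch_smul, ← Finset.smul_sum]
      rw [smul_smul, mul_inv_cancel₀ h0, one_smul]

/-- Each component is assigned one slot by choice; the weight of a slot is the total trace of its
components. A slot receiving none still needs a normalised term, whence `hQ₀`. -/
theorem IsMixture.exists_split {n : ℕ} {W : Op J O} (h : IsMixture e P W)
    (Q : Fin n → ((∀ k, O k) → ∀ k, I k) → Prop) (hQ : ∀ w, P w → ∃ k, Q k w)
    (hQ₀ : ∀ k, ∃ w, Q k w) :
    ∃ (q : Fin n → ℝ) (V : Fin n → Op J O), (∀ k, 0 ≤ q k) ∧ ∑ k, q k = 1 ∧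
      W = ∑ k, (q k : ℂ) • V k ∧ ∀ k, IsMixture e (Q k) (V k) := by
  classical
  have := h.nonempty_aux
  obtain ⟨S, hS, w, ρ, hP, hρ, htr, rfl⟩ := h
  choose κ hκ using fun s => hQ _ (hP s)
  choose V hq hV hsum using fun k => exists_isMixture_smul (e := e) (hQ₀ k)
    (S := {s // κ s = k}) (fun s => w s) (fun s => ρ s)
    (by rintro ⟨s, rfl⟩; exact hκ s) (fun s => hρ s)
  refine ⟨fun k => (∑ s : {s // κ s = k}, (ρ s).trace).re, V, hq, ?_, ?_, hV⟩
  · rw [← Complex.re_sum, Fintype.sum_fiberwise κ fun s => (ρ s).trace, htr, Complex.one_re]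
  · simp only [← hsum]
    rw [Fintype.sum_fiberwise κ fun s => branch e (w s) (ρ s)]

end

section Extend

variable {d : Fin T → ℕ}

/-- The product of an operator on auxiliary spaces with an operator on further auxiliary spaces. -/
def auxProd (ρ : Matrix (∀ k, A k) (∀ k, A k) ℂ)
    (τ : Matrix (∀ k, Fin (d k)) (∀ k, Fin (d k)) ℂ) :
    Matrix (∀ k, A k × Fin (d k)) (∀ k, A k × Fin (d k)) ℂ :=
  (Matrix.kronecker ρ τ).submatrix (Equiv.arrowProdEquivProdArrow _ _ _)
    (Equiv.arrowProdEquivProdArrow _ _ _)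

/-- The basis of an extended input space. -/
abbrev extendEquiv (e : ∀ k, J k ≃ I k × A k) (d : Fin T → ℕ) (k : Fin T) :
    J k × Fin (d k) ≃ I k × (A k × Fin (d k)) :=
  ((e k).prodCongr (Equiv.refl _)).trans (Equiv.prodAssoc _ _ _)

theorem extend_branch (e : ∀ k, J k ≃ I k × A k) (w : (∀ k, O k) → ∀ k, I k)
    (ρ : Matrix (∀ k, A k) (∀ k, A k) ℂ) (τ : Matrix (∀ k, Fin (d k)) (∀ k, Fin (d k)) ℂ) :
    extend (branch e w ρ) τ = branch (extendEquiv e d) w (auxProd ρ τ) := by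
  ext x y
  simp only [extend, branch, ite_mul, zero_mul]
  rfl

theorem IsMixture.extend [∀ k, Fintype (A k)] {e : ∀ k, J k ≃ I k × A k}
    {P : ((∀ k, O k) → ∀ k, I k) → Prop} {W : Op J O} (h : IsMixture e P W)
    {τ : Matrix (∀ k, Fin (d k)) (∀ k, Fin (d k)) ℂ} (hτ : IsState τ) :
    IsMixture (extendEquiv e d) P (CausalProcess.extend W τ) := by
  obtain ⟨S, hS, w, ρ, hP, hρ, htr, rfl⟩ := h
  refine ⟨S, hS, w, fun s => auxProd (ρ s) τ, hP,
    fun s => ((hρ s).kronecker hτ.1).submatrix _, ?_, ?_⟩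
  · have : ∀ s, (auxProd (ρ s) τ).trace = (ρ s).trace := by
      intro s
      rw [← mul_one (ρ s).trace, ← hτ.2, ← Matrix.trace_kronecker]
      exact Equiv.sum_comp (Equiv.arrowProdEquivProdArrow _ _ _)
        fun p => Matrix.kronecker (ρ s) τ p p
    simp only [this, htr]
  · ext x y
    simp only [← extend_branch]
    simp only [CausalProcess.extend, Matrix.sum_apply, Finset.sum_mul]

end Extend

/-! ### Normalisation and no-signalling of mixtures -/

section Normalisation

variable [∀ k, Fintype (I k)] [∀ k, Fintype (A k)] [∀ k, Fintype (J k)] [∀ k, Fintype (O k)]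
  [∀ k, Nonempty (O k)] {e : ∀ k, J k ≃ I k × A k} {P : ((∀ k, O k) → ∀ k, I k) → Prop}

open Classical in
omit [∀ k, Fintype (I k)] [∀ k, Fintype (A k)] [∀ k, Fintype (J k)] [∀ k, Nonempty (O k)] in
theorem IsChannel.sum_symm (e : ∀ k, J k ≃ I k × A k) {k : Fin T}
    {M : Matrix (J k × O k) (J k × O k) ℂ}
    (hM : IsChannel M) (i : I k) (α β : A k) :
    ∑ o, M ((e k).symm (i, α), o) ((e k).symm (i, β), o) = if α = β then 1 else 0 := by
  rw [hM.2]
  simp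

/-- For fixed auxiliary indices `a`, `b`, trace preservation makes the row sums of the channel
blocks equal to Kronecker deltas, so the product formula leaves exactly the trace of each `ρ s`. -/
theorem IsMixture.isProcessMatrix {W : Op J O} (h : IsMixture e P W)
    (hP : ∀ w, P w → IsProcessFunction w) : IsProcessMatrix W := by
  classical
  obtain ⟨S, hS, w, ρ, hPw, hρ, htr, rfl⟩ := h
  refine ⟨Matrix.posSemidef_sum _ fun s _ => branch_posSemidef e _ (hρ s), fun M hM => ?_⟩
  rw [evaluate_sum, ← htr]
  refine Finset.sum_congr rfl fun s _ => ?_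
  rw [evaluate_branch, Matrix.trace]
  refine Finset.sum_congr rfl fun a _ => ?_
  have hab : ∀ b : ∀ k, A k, ∑ o : ∀ k, O k, ∏ k, M k ((e k).symm (w s o k, a k), o k)
      ((e k).symm (w s o k, b k), o k) = ∏ k, if a k = b k then 1 else 0 := fun b =>
    (hP _ (hPw s)).sum_prod (fun k i o => M k ((e k).symm (i, a k), o) ((e k).symm (i, b k), o)) _
      fun k i => (hM k).sum_symm e i _ _
  simp only [hab]
  rw [Fintype.sum_eq_single a]
  · simp
  · intro b hb
    obtain ⟨k, hk⟩ := Function.ne_iff.1 hb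
    rw [Finset.prod_eq_zero (Finset.mem_univ k) (if_neg hk.symm), mul_zero]

theorem IsMixture.compatibleFirst {W : Op J O} (h : IsMixture e P W) (k : Fin T)
    (hP : ∀ w, P w → IsProcessFunction w ∧ ∃ i : I k, ∀ o, w o k = i) : CompatibleFirst W k := by
  classical
  obtain ⟨S, hS, w, ρ, hPw, hρ, htr, rfl⟩ := h
  have key : ∀ (s : S) (i : I k) (_ : ∀ o, w s o k = i) (a b : ∀ k, A k)
      (M : ∀ j, Matrix (J j × O j) (J j × O j) ℂ) (_ : ∀ j, j ≠ k → IsChannel (M j)),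
      ∑ o : ∀ k, O k, ∏ j, M j ((e j).symm (w s o j, a j), o j)
        ((e j).symm (w s o j, b j), o j) =
      ∏ j, Function.update (fun j => if a j = b j then (1 : ℂ) else 0) k
        (∑ o, M k ((e k).symm (i, a k), o) ((e k).symm (i, b k), o)) j := by
    intro s i hi a b M hM
    -- `M k` need not be a channel. As slot `k` always receives `i`, its kernel may be frozen at
    -- that input, which makes its row sums constant.
    rw [← (hP _ (hPw s)).1.sum_prod (Function.update
      (fun j i o => M j ((e j).symm (i, a j), o) ((e j).symm (i, b j), o)) k
      fun _ o => M k ((e k).symm (i, a k), o) ((e k).symm (i, b k), o))]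
    · refine Finset.sum_congr rfl fun o _ => Finset.prod_congr rfl fun j _ => ?_
      by_cases hj : j = k
      · subst hj; simp [hi]
      · simp [hj]
    · intro j i'
      by_cases hj : j = k
      · subst hj; simp
      · simpa [hj] using (hM j hj).sum_symm e i' (a j) (b j)
  intro M N hMN _ hM hN
  rw [evaluate_sum, evaluate_sum]
  refine Finset.sum_congr rfl fun s _ => ?_
  obtain ⟨i, hi⟩ := (hP _ (hPw s)).2
  rw [evaluate_branch, evaluate_branch]
  simp only [key s i hi _ _ M hM, key s i hi _ _ N hN, hMN]

end Normalisation
end Mixture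

/-! ### Conditioning mixtures, and separability from definiteness -/

section Conditional

variable {T : ℕ} {I : Fin (T + 1) → Type*} {A : Fin (T + 1) → Type*} {J : Fin (T + 1) → Type*}
  {O : Fin (T + 1) → Type v} [∀ k, Fintype (I k)] [∀ k, Fintype (A k)] [∀ k, Fintype (J k)]
  [∀ k, Fintype (O k)] [∀ k, Nonempty (O k)]

omit [∀ k, Nonempty (O k)] in
theorem conditional_sum {S : Type*} (s : Finset S) (W : S → Op J O) (k : Fin (T + 1))
    (M : Matrix (J k × O k) (J k × O k) ℂ) :
    conditional (∑ i ∈ s, W i) k M = ∑ i ∈ s, conditional (W i) k M := by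
  ext x y
  simp only [conditional, Matrix.sum_apply, Finset.sum_mul]
  conv_rhs => rw [Finset.sum_comm]
  exact Finset.sum_congr rfl fun _ _ => Finset.sum_comm

theorem IsMixture.conditional {e : ∀ k, J k ≃ I k × A k} {P : ((∀ k, O k) → ∀ k, I k) → Prop}
    {W : Op J O} (h : IsMixture e P W) (k : Fin (T + 1))
    {Q : ((∀ j, O (k.succAbove j)) → ∀ j, I (k.succAbove j)) → Prop}
    (hP : ∀ w, P w → (∃ i : I k, ∀ o, w o k = i) ∧ ∀ o, Q (reduced w k fun _ => o))
    (hQ₀ : ∃ w, Q w) {M : Matrix (J k × O k) (J k × O k) ℂ} (hM : IsCPMap M) :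
    ∃ (c : ℝ) (U : Op (fun j => J (k.succAbove j)) fun j => O (k.succAbove j)), 0 ≤ c ∧
      IsMixture (fun j => e (k.succAbove j)) Q U ∧ conditional W k M = (c : ℂ) • U := by
  have := h.nonempty_aux
  obtain ⟨S, hS, w, ρ, hPw, hρ, htr, rfl⟩ := h
  choose i hi using fun s => (hP _ (hPw s)).1
  -- Branches are now indexed by `S × O k`; taking `S` in the universe of the outputs keeps the
  -- class of mixtures stable.
  let σ : S × O k → Matrix (∀ j, A (k.succAbove j)) (∀ j, A (k.succAbove j)) ℂ := fun p =>
    linkSlot k (ρ p.1) fun α β => M ((e k).symm (i p.1, α), p.2) ((e k).symm (i p.1, β), p.2)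
  have hσ : ∀ p, (σ p).PosSemidef := fun p => linkSlot_posSemidef k (hρ p.1)
    (hM.submatrix fun α => ((e k).symm (i p.1, α), p.2))
  obtain ⟨U, hc, hU, hsum⟩ := exists_isMixture_smul (e := fun j => e (k.succAbove j)) hQ₀
    (fun p : S × O k => reduced (w p.1) k fun _ => p.2) σ (fun p => (hP _ (hPw p.1)).2 p.2) hσ
  refine ⟨_, U, hc, hU, ?_⟩
  rw [← hsum, conditional_sum, Fintype.sum_prod_type]
  exact Finset.sum_congr rfl fun s _ => conditional_branch e k (hi s) (ρ s) M

end Conditional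

theorem IsMixture.isCausallySeparable (n : ℕ) {I : Fin (n + 1) → Type u₁} {A : Fin (n + 1) → Type u₂}
    {J : Fin (n + 1) → Type u} {O : Fin (n + 1) → Type v} [∀ k, Fintype (I k)]
    [∀ k, Nonempty (I k)] [∀ k, Fintype (A k)] [∀ k, Fintype (J k)] [∀ k, Fintype (O k)]
    [∀ k, Nonempty (O k)] (e : ∀ k, J k ≃ I k × A k) {W : Op J O}
    (h : IsMixture e (fun w => IsProcessFunction w ∧ IsCausallyDefinite (n + 1) I O w) W) :
    IsCausallySeparable (n + 1) J O W := by
  induction n with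
  | zero => exact h.isProcessMatrix fun w hw => hw.1
  | succ n ih =>
    refine ⟨h.isProcessMatrix fun w hw => hw.1, fun d τ hτ => ?_⟩
    let Q : Fin (n + 2) → ((∀ k, O k) → ∀ k, I k) → Prop := fun k w =>
      IsProcessFunction w ∧ (∃ i : I k, ∀ o, w o k = i) ∧ ∀ μ : I k → O k,
        IsCausallyDefinite (n + 1) (fun j => I (k.succAbove j)) (fun j => O (k.succAbove j))
          (reduced w k μ)
    have i₀ : ∀ k, I k := fun k => Classical.arbitrary _
    obtain ⟨q, V, hq, hq1, hV, hmix⟩ := (h.extend hτ).exists_split Q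
      (fun w hw => hw.2.imp fun k hk => ⟨hw.1, hk⟩)
      -- Constant functions lie in every class `Q k` and fill the terms of weight zero.
      fun k => ⟨fun _ => i₀, isProcessFunction_const _, ⟨i₀ k, fun _ => rfl⟩,
        fun μ => isCausallyDefinite_const _ _ _ _⟩
    refine ⟨q, V, hq, hq1, hV, fun k => ⟨(hmix k).isProcessMatrix fun w hw => hw.1,
      (hmix k).compatibleFirst k fun w hw => ⟨hw.1, hw.2.1⟩, fun M hM => ?_⟩⟩
    obtain ⟨c, U, hc, hU, hcond⟩ := (hmix k).conditional k
      (Q := fun w => IsProcessFunction w ∧ IsCausallyDefinite (n + 1) (fun j => I (k.succAbove j))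
        (fun j => O (k.succAbove j)) w)
      (fun w hw => ⟨hw.2.1, fun o => ⟨hw.1.reduced k _, hw.2.2 _⟩⟩)
      ⟨fun _ j => i₀ (k.succAbove j), isProcessFunction_const _, isCausallyDefinite_const _ _ _ _⟩
      hM
    exact ⟨c, U, hc, ih _ hU, hcond⟩


/-! ### Definiteness from separability, via diagonals -/

section Converse

open Classical in
/-- The Choi matrix of the classical channel implementing the function `μ`. -/
noncomputable def detChannel {X : Type*} {Y : Type*} (μ : X → Y) : Matrix (X × Y) (X × Y) ℂ :=
  Matrix.diagonal fun p => if p.2 = μ p.1 then 1 else 0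

theorem isChannel_detChannel {X : Type*} {Y : Type*} [Fintype Y] (μ : X → Y) :
    IsChannel (detChannel μ) := by
  classical
  refine ⟨Matrix.PosSemidef.diagonal fun p => ?_, fun x x' => ?_⟩
  · simp only [Pi.zero_apply]
    split_ifs <;> simp
  · by_cases h : x = x'
    · subst h; simp [detChannel]
    · simp [detChannel, h]

section

variable {T : ℕ} {I : Fin T → Type*} {J : Fin T → Type*} {O : Fin T → Type*}
  [∀ k, Fintype (J k)] [∀ k, Fintype (O k)]

open Classical in
/-- The diagonal of `W` is the graph of `w`, up to the relabelling `e` of the inputs. -/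
def DiagEq (e : ∀ k, J k ≃ I k) (w : (∀ k, O k) → ∀ k, I k) (W : Op J O) : Prop :=
  ∀ x, W x x = if w (fun k => (x k).2) = (fun k => e k (x k).1) then 1 else 0

open Classical in
theorem evaluate_diagonal (W : Op J O) (f : ∀ k, J k × O k → ℂ) :
    evaluate W (fun k => Matrix.diagonal (f k)) = ∑ x, W x x * ∏ k, f k (x k) := by
  rw [evaluate_eq_sum]
  refine Finset.sum_congr rfl fun x _ => ?_
  rw [Fintype.sum_eq_single x]
  · simp
  · intro y hy
    obtain ⟨k, hk⟩ := Function.ne_iff.1 hy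
    exact mul_eq_zero_of_right _
      (Finset.prod_eq_zero (Finset.mem_univ k) (Matrix.diagonal_apply_ne (f k) hk.symm))

/-- Channels with constant output `o` pick out the diagonal entries with that output. Only the one
on the graph can be nonzero, so normalisation forces it to be 1. -/
theorem IsProcessMatrix.diagEq {V : Op J O} (hV : IsProcessMatrix V) (e : ∀ k, J k ≃ I k)
    {w : (∀ k, O k) → ∀ k, I k}
    (h : ∀ x, V x x ≠ 0 → w (fun k => (x k).2) = fun k => e k (x k).1) : DiagEq e w V := by
  classical
  intro x
  split_ifs with hx
  · have h1 := hV.2 (fun k => detChannel fun _ => (x k).2) fun k => isChannel_detChannel _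
    unfold detChannel at h1
    rw [evaluate_diagonal, Fintype.sum_eq_single x] at h1
    · simpa using h1
    · intro y hy
      by_contra hne
      obtain ⟨hVy, hprod⟩ := mul_ne_zero_iff.1 hne
      have hout : ∀ k, (y k).2 = (x k).2 := fun k => by
        by_contra hk
        exact Finset.prod_ne_zero_iff.1 hprod k (Finset.mem_univ k) (if_neg hk)
      apply hy
      have hin := h y hVy
      simp only [hout] at hin
      rw [hx] at hin
      funext k
      exact Prod.ext ((e k).injective (congrFun hin k).symm) (hout k)
  · by_contra hne
    exact hx (h x hne)

/-- Slot `k` tests whether its input is `w o k`, while the other slots emit fixed outputs. The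
outcome probability is 0 or 1, and compatibility forbids it to depend on those outputs. -/
theorem DiagEq.apply_eq_of_compatibleFirst {V : Op J O} {e : ∀ k, J k ≃ I k} {w : (∀ k, O k) → ∀ k, I k}
    (hV : DiagEq e w V) (hw : IsProcessFunction w) {k : Fin T} (hk : CompatibleFirst V k)
    (o o' : ∀ k, O k) : w o k = w o' k := by
  classical
  let F : (∀ k, O k) → ∀ j, J j × O j → ℂ := fun o' j p =>
    if p.2 = o' j ∧ (j = k → e j p.1 = w o j) then 1 else 0
  have hF : ∀ o', evaluate V (fun j => Matrix.diagonal (F o' j)) =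
      if w o' k = w o k then 1 else 0 := by
    intro o'
    rw [evaluate_diagonal, Fintype.sum_eq_single fun j => ((e j).symm (w o' j), o' j)]
    · rw [hV]
      simp only [Equiv.apply_symm_apply, if_true, one_mul, F, true_and]
      by_cases h : w o' k = w o k
      · rw [if_pos h]
        exact Finset.prod_eq_one fun j _ => if_pos (by rintro rfl; exact h)
      · rw [if_neg h]
        exact Finset.prod_eq_zero (Finset.mem_univ k) (if_neg fun h' => h (h' rfl))
    · intro y hy
      by_contra hne
      obtain ⟨hVy, hprod⟩ := mul_ne_zero_iff.1 hne
      have hout : ∀ j, (y j).2 = o' j := fun j => by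
        by_contra hj
        exact Finset.prod_ne_zero_iff.1 hprod j (Finset.mem_univ j) (if_neg fun h => hj h.1)
      rw [hV] at hVy
      have hin := (ne_eq _ _ ▸ fun h => hVy (if_neg h) : ¬¬ _)
      rw [not_not] at hin
      apply hy
      funext j
      refine Prod.ext ((e j).injective ?_) (hout j)
      rw [Equiv.apply_symm_apply, ← congrFun hin j]
      simp only [hout]
  have hchan : ∀ o' j, j ≠ k → IsChannel (Matrix.diagonal (F o' j)) := by
    intro o' j hj
    have : Matrix.diagonal (F o' j) = detChannel fun _ => o' j := by
      simp [F, detChannel, hj]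
    rw [this]
    exact isChannel_detChannel _
  -- Compatibility requires the same map in slot `k` on both sides; changing `o' k` to `o k`
  -- achieves this without affecting the input of slot `k`.
  set o'' := Function.update o' k (o k) with ho''
  have h1 : w o'' k = w o' k := by
    have := hw.apply_update k o' (o k) (o' k)
    rwa [Function.update_eq_self] at this
  have h := hk (fun j => Matrix.diagonal (F o j)) (fun j => Matrix.diagonal (F o'' j))
    (by simp [F, ho'']) (Matrix.PosSemidef.diagonal fun p => by
      simp only [Pi.zero_apply, F]
      split_ifs <;> simp) (hchan o) (hchan o'')
  rw [hF, hF, if_pos rfl] at h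
  by_contra hne
  rw [if_neg fun h2 => hne (h2.symm.trans h1)] at h
  exact one_ne_zero h

end

/-- A diagonal operation sees only the diagonal of `V` on slot `k`; the single surviving term has
the slot input `i₀` and the output `μ i₀`. -/
theorem DiagEq.conditional {T : ℕ} {I : Fin (T + 1) → Type*} {J : Fin (T + 1) → Type*}
    {O : Fin (T + 1) → Type*} [∀ k, Fintype (J k)] [∀ k, Fintype (O k)] [∀ k, Nonempty (O k)]
    {V : Op J O} {e : ∀ k, J k ≃ I k} {w : (∀ k, O k) → ∀ k, I k}
    (hV : DiagEq e w V) (hw : IsProcessFunction w) (k : Fin (T + 1)) (μ : I k → O k) :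
    DiagEq (fun j => e (k.succAbove j)) (reduced w k μ)
      (conditional V k (detChannel fun i => μ (e k i))) := by
  classical
  intro x
  set i₀ := slotInput w k fun j => (x j).2 with hi₀
  have hterm : ∀ a : J k × O k, V (k.insertNth (α := fun j => J j × O j) a x)
      (k.insertNth (α := fun j => J j × O j) a x) =
      if e k a.1 = i₀ ∧ (fun j => w (k.insertNth (α := O) a.2 fun j => (x j).2) (k.succAbove j)) =
        (fun j => e (k.succAbove j) (x j).1) then 1 else 0 := by
    intro a
    rw [hV, insertNth_map k (fun j (z : J j × O j) => z.2),
      insertNth_map k (fun j (z : J j × O j) => e j z.1)]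
    refine if_congr ?_ rfl rfl
    rw [Fin.eq_insertNth_iff, hw.apply_insertNth_self]
    exact and_congr eq_comm Iff.rfl
  have hb : ∀ a : J k × O k, ∑ b, V (k.insertNth (α := fun j => J j × O j) a x)
      (k.insertNth (α := fun j => J j × O j) b x) * detChannel (fun i => μ (e k i)) a b =
      V (k.insertNth (α := fun j => J j × O j) a x) (k.insertNth (α := fun j => J j × O j) a x) *
        if a.2 = μ (e k a.1) then 1 else 0 := by
    intro a
    rw [Fintype.sum_eq_single a]
    · simp [detChannel]
    · intro b hb
      rw [detChannel, Matrix.diagonal_apply_ne _ hb.symm, mul_zero]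
  simp only [CausalProcess.conditional]
  rw [Finset.sum_congr rfl fun a _ => hb a, Fintype.sum_eq_single ((e k).symm i₀, μ i₀)]
  · rw [hterm]
    simp only [Equiv.apply_symm_apply, if_true, mul_one, true_and]
    rfl
  · intro a ha
    rw [hterm]
    by_contra hne
    obtain ⟨h1, h2⟩ := mul_ne_zero_iff.1 hne
    have h1' := (ite_ne_right_iff.1 h1).1.1
    have h2' := (ite_ne_right_iff.1 h2).1
    exact ha (Prod.ext ((e k).injective (by simp [h1'])) (by rw [h2', h1']))

theorem IsCausallySeparable.isProcessMatrix {n : ℕ} {J : Fin n → Type u} {O : Fin n → Type v}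
    [∀ k, Fintype (J k)] [∀ k, Fintype (O k)] {W : Op J O} (h : IsCausallySeparable n J O W) :
    IsProcessMatrix W := by
  rcases n with _ | _ | n
  · exact h
  · exact h
  · exact h.1

/-- The hypothesis concerns only the diagonal because the terms of a decomposition need not be
diagonal matrices; `e` absorbs the trivial factors added by successive extensions. -/
theorem IsCausallySeparable.isCausallyDefinite (n : ℕ) {I : Fin (n + 1) → Type u₁}
    {J : Fin (n + 1) → Type u} {O : Fin (n + 1) → Type v} [∀ k, Fintype (J k)]
    [∀ k, Fintype (O k)] [∀ k, Nonempty (O k)] (e : ∀ k, J k ≃ I k)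
    {w : (∀ k, O k) → ∀ k, I k} (hw : IsProcessFunction w) {W : Op J O} (hdiag : DiagEq e w W)
    (hW : IsCausallySeparable (n + 1) J O W) : IsCausallyDefinite (n + 1) I O w := by
  induction n with
  | zero => trivial
  | succ n ih =>
    classical
    obtain ⟨q, V, hq, hq1, hsum, hV⟩ := hW.2 (fun _ => 1) 1
      ⟨Matrix.PosSemidef.one, by simp [Matrix.trace]⟩
    obtain ⟨k, hk⟩ : ∃ k, q k ≠ 0 := by
      by_contra! h
      simp [h] at hq1
    let e' : ∀ k, J k × Fin 1 ≃ I k := fun k => (Equiv.prodUnique _ _).trans (e k)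
    have hVk : DiagEq e' w (V k) := by
      refine (hV k).1.diagEq e' fun x hx => ?_
      by_contra hne
      have h0 : ∑ j, (q j : ℂ) * V j x x = 0 := by
        have := congrFun (congrFun hsum x) x
        simp only [extend, Matrix.sum_apply, Matrix.smul_apply, smul_eq_mul] at this
        rw [← this, hdiag]
        exact mul_eq_zero_of_left (if_neg hne) _
      -- Off the graph, nonnegative diagonal entries sum to zero, so each weighted entry vanishes.
      have h1 := (Finset.sum_eq_zero_iff_of_nonneg fun j _ => mul_nonneg
        (Complex.zero_le_real.2 (hq j)) ((hV j).1.1.diag_nonneg)).1 h0 k (Finset.mem_univ k)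
      exact mul_ne_zero (Complex.ofReal_ne_zero.2 hk) hx h1
    refine ⟨k, ⟨w (fun _ => Classical.arbitrary _) k,
      fun o => hVk.apply_eq_of_compatibleFirst hw (hV k).2.1 _ _⟩, fun μ => ?_⟩
    obtain ⟨c, U, -, hU, hcond⟩ := (hV k).2.2 _ (isChannel_detChannel fun i => μ (e' k i)).1
    have hc := hVk.conditional hw k μ
    rw [hcond] at hc
    -- Only the support of the diagonal of `U` is needed, so `c ≠ 0` suffices; it holds because the
    -- conditional matrix has a diagonal entry 1 on the graph.
    refine ih (fun j => e' (k.succAbove j)) (hw.reduced k μ) (hU.isProcessMatrix.diagEq _ ?_) hU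
    intro x hx
    have hc0 : (c : ℂ) ≠ 0 := by
      intro h0
      let o : ∀ j, O (k.succAbove j) := fun _ => Classical.arbitrary _
      have := hc fun j => ((e' (k.succAbove j)).symm (reduced w k μ o j), o j)
      simp [h0] at this
    by_contra hne
    have := hc x
    rw [if_neg hne, Matrix.smul_apply, smul_eq_mul] at this
    exact mul_ne_zero hc0 hx this

end Converse
end CausalProcess

theorem mainTheorem8 {T : ℕ} (hT : 1 ≤ T) {I : Fin T → Type*} {O : Fin T → Type*}
    [∀ k, Fintype (I k)] [∀ k, Nonempty (I k)] [∀ k, Fintype (O k)] [∀ k, Nonempty (O k)]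
    (w : (∀ k, O k) → ∀ k, I k) (hw : CausalProcess.IsProcessFunction w) :
    CausalProcess.IsCausallyDefinite T I O w ↔
      CausalProcess.IsCausallySeparable T I O (CausalProcess.processMatrix w) := by
  classical
  obtain ⟨n, rfl⟩ := Nat.exists_eq_succ_of_ne_zero (Nat.one_le_iff_ne_zero.1 hT)
  constructor
  · intro h
    -- With one-dimensional auxiliary spaces the process matrix is a single branch, the base of the
    -- mixture argument.
    let e : ∀ k, I k ≃ I k × PUnit.{1} := fun k => (Equiv.prodPUnit (I k)).symm
    have hmix := CausalProcess.isMixture_branch (e := e) (w := w)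
      (P := fun w => CausalProcess.IsProcessFunction w ∧
        CausalProcess.IsCausallyDefinite (n + 1) I O w) (ρ := 1) ⟨hw, h⟩
      ⟨Matrix.PosSemidef.one, by simp [Matrix.trace]⟩
    have hW : CausalProcess.processMatrix w = CausalProcess.branch e w 1 := by
      ext x y
      have hxy : x = y ↔ (fun k => (x k).2) = (fun k => (y k).2) ∧
          (fun k => (x k).1) = (fun k => (y k).1) := by
        simp only [funext_iff, Prod.ext_iff, ← forall_and, and_comm]
      simp only [CausalProcess.processMatrix, CausalProcess.branch, Matrix.diagonal_apply,
        Matrix.one_apply_eq, e, Equiv.prodPUnit_symm_apply]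
      rw [← ite_and]
      refine if_congr ?_ rfl rfl
      rw [hxy]
      constructor
      · rintro ⟨⟨h1, h2⟩, h3⟩
        exact ⟨h1, h3, by rw [← h1, ← h2, h3]⟩
      · rintro ⟨h1, h2, h3⟩
        exact ⟨⟨h1, by rw [← h2, ← h3, h1]⟩, h2⟩
    rw [hW]
    exact hmix.isCausallySeparable n e
  · refine CausalProcess.IsCausallySeparable.isCausallyDefinite n (fun _ => Equiv.refl _) hw ?_
    intro x
    rw [CausalProcess.processMatrix, Matrix.diagonal_apply_eq]
    exact if_congr Iff.rfl rfl rfl
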